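/- **Theorem.** Throughout, an $\infty$-category is a quasicategory, and $f\simeq g$ means that the edges $f,g:A\to B$ are homotopic, i.e. equivalent as vertices of the Kan complex $\mathcal K(A,B)$. *(Co)limits.* An $\omega$-diagram $K_0\xrightarrow{f_0}K_1\xrightarrow{f_1}\cdots$ in an $\infty$-category is a sequence of vertices and edges. A cocone on it is a vertex $K$ with edges $\delta_i:K_i\to K$ such that $\delta_{i+1}\circ f_i\simeq\delta_i$ for all $i$. It is a colimit if for every cocone $(K',(\delta_i'))$ there is an edge $h:K\to K'$, unique up to homotopy, with $h\circ\delta_i\simeq\delta'_i$ for all $i$. Limits of $\omega^{op}$-diagrams $K_0\leftarrow K_1\leftarrow\cdots$ are defined dually. A functor is $\omega$-continuous if it sends colimits of $\omega$-diagrams to colimits. *$(0,\infty)$-categories.* A $(0,\infty)$-category is an $\infty$-category $\mathcal K$ in which every Kan complex $\mathcal K(A,B)$ is equipped with a transitive relation $\precsim$ on its vertices such that $f\simeq g$ implies $f\precsim g$; $f\precsim g\precsim f$ implies $f\simeq g$; every $\omega$-chain $f_0\precsim f_1\precsim\cdots$ has a supremum $\bigvee_i f_i$ (unique up to $\simeq$);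 and there is a least element $0_{A,B}$. Moreover composition is continuous, $(\bigvee_i g_i)\circ(\bigvee_i f_i)\simeq\bigvee_i(g_i\circ f_i)$ for $\omega$-chains $(f_i)$ in $\mathcal K(A,B)$ and $(g_i)$ in $\mathcal K(B,C)$ (the right-hand supremum being part of the assertion), and $0_{B,C}\circ f\simeq 0_{A,C}$ for every $f:A\to B$. *$h$-projection pairs.* An $h$-projection pair from $A$ to $B$ is a pair $(f^+:A\to B,\ f^-:B\to A)$ with $f^-\circ f^+\simeq I_A$ and $f^+\circ f^-\precsim I_B$. The $\infty$-category $\mathcal K^{HPrj}$ is the simplicial subset of $\mathcal K\times\mathcal K^{op}$ whose $n$-simplices are the pairs $(\sigma^+,\sigma^-)$ all of whose edges are $h$-projection pairs; so it has the objects of $\mathcal K$ as objects and the $h$-projection pairs as edges. *Local continuity.* A functor $F:\mathcal K^{op}\times\mathcal K\to\mathcal K$ is locally continuous if for all $\omega$-chains $(f_i)$ in $\mathcal K^{op}(A,B)$ and $(g_i)$ in $\mathcal K(C,D)$ the edge $F(\bigvee_i f_i,\bigvee_i g_i)$ is a supremum of the edges $F(f_i,g_i)$. For such $F$, $$F^{+-}\big((\sigma^+,\sigma^-),(\tau^+,\tau^-)\big)=\big(F(\sigma^-,\tau^+),\,F(\sigma^+,\tau^-)\big)$$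 defines a functor $F^{+-}:\mathcal K^{HPrj}\times\mathcal K^{HPrj}\to\mathcal K^{HPrj}$. **Claim.** Let $\mathcal K$ be a $(0,\infty)$-category in which every $\omega^{op}$-diagram has a limit, and let $F:\mathcal K^{op}\times\mathcal K\to\mathcal K$ be a locally continuous functor. Then $F^{+-}:\mathcal K^{HPrj}\times\mathcal K^{HPrj}\to\mathcal K^{HPrj}$ is $\omega$-continuous. -/

import Mathlib

open CategoryTheory Simplicial MonoidalCategory

universe u

namespace HomotopyDomain

open SSet SSet.Edge

/-! ### Edges, homotopies and composites in a simplicial set -/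

/-- `f ≃ g` for two edges `f, g : x ⟶ y`: there is a `2`-simplex with boundary `(f, id, g)`.
In a quasicategory this is the usual equivalence relation of homotopy of edges, i.e. `f` and `g`
are equivalent vertices of the mapping space (Kan complex) from `x` to `y`. -/
def Homotopic {X : SSet.{u}} {x y : X _⦋0⦌} (f g : Edge x y) : Prop :=
  Nonempty (CompStruct f (Edge.id y) g)

/-- `h` is a composite (up to homotopy) of `f : x ⟶ y` followed by `g : y ⟶ z`. -/
def IsComp {X : SSet.{u}} {x y z : X _⦋0⦌} (f : Edge x y) (g : Edge y z) (h : Edge x z) : Prop :=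
  Nonempty (CompStruct f g h)

/-- A vertex of `X`, seen as a vertex of the opposite simplicial set. -/
def opVertex {X : SSet.{u}} (x : X _⦋0⦌) : X.op _⦋0⦌ := opObjEquiv.symm x

/-- An edge `x ⟶ y` of `X`, seen as an edge `y ⟶ x` of the opposite simplicial set. -/
def opEdge {X : SSet.{u}} {x y : X _⦋0⦌} (f : Edge x y) : Edge (opVertex y) (opVertex x) :=
  Edge.mk (X := X.op) (opObjEquiv.symm f.edge)
    ((op_δ X 1 _).trans (congrArg opObjEquiv.symm f.tgt_eq))
    ((op_δ X 0 _).trans (congrArg opObjEquiv.symm f.src_eq))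

/-- The edge `(f, g)` of a product of simplicial sets. -/
def pairEdge {X Y : SSet.{u}} {x x' : X _⦋0⦌} {y y' : Y _⦋0⦌} (f : Edge x x') (g : Edge y y') :
    Edge (X := X ⊗ Y) (x, y) (x', y') :=
  Edge.mk (X := X ⊗ Y) (f.edge, g.edge) (Prod.ext f.src_eq g.src_eq) (Prod.ext f.tgt_eq g.tgt_eq)

/-! ### `ω`-diagrams, their colimits, and `ω`-continuous functors -/

/-- An `ω`-diagram `K₀ ⟶ K₁ ⟶ K₂ ⟶ ⋯`. -/
structure OmegaDiagram (X : SSet.{u}) where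
  obj : ℕ → X _⦋0⦌
  map : ∀ i, Edge (obj i) (obj (i + 1))

/-- A cocone `(K, {δ i : K i ⟶ K})` on an `ω`-diagram: `δ (i + 1) ∘ f i ≃ δ i` for all `i`. -/
structure OmegaCocone {X : SSet.{u}} (D : OmegaDiagram X) where
  pt : X _⦋0⦌
  ι : ∀ i, Edge (D.obj i) pt
  w : ∀ i, IsComp (D.map i) (ι (i + 1)) (ι i)

/-- `h` is a mediating edge between the cocones `c` and `c'`. -/
def OmegaCocone.IsMediating {X : SSet.{u}} {D : OmegaDiagram X} (c c' : OmegaCocone D)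
    (h : Edge c.pt c'.pt) : Prop :=
  ∀ i, IsComp (c.ι i) h (c'.ι i)

/-- A cocone is a colimit if every cocone receives a mediating edge from it, which is unique
up to homotopy. -/
def OmegaCocone.IsColimit {X : SSet.{u}} {D : OmegaDiagram X} (c : OmegaCocone D) : Prop :=
  ∀ c' : OmegaCocone D, ∃ h : Edge c.pt c'.pt, c.IsMediating c' h ∧
    ∀ h' : Edge c.pt c'.pt, c.IsMediating c' h' → Homotopic h h'

/-- The image of an `ω`-diagram under a functor. -/
def OmegaDiagram.mapDiagram {X Y : SSet.{u}} (D : OmegaDiagram X) (φ : X ⟶ Y) :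
    OmegaDiagram Y where
  obj i := φ.app _ (D.obj i)
  map i := (D.map i).map φ

/-- The image of a cocone under a functor. -/
def OmegaCocone.mapCocone {X Y : SSet.{u}} {D : OmegaDiagram X} (c : OmegaCocone D) (φ : X ⟶ Y) :
    OmegaCocone (D.mapDiagram φ) where
  pt := φ.app _ c.pt
  ι i := (c.ι i).map φ
  w i := (c.w i).map fun s ↦ s.map φ

/-- A functor is `ω`-continuous if it preserves all colimits of `ω`-diagrams. -/
def IsOmegaContinuous {X Y : SSet.{u}} (φ : X ⟶ Y) : Prop :=
  ∀ (D : OmegaDiagram X) (c : OmegaCocone D), c.IsColimit → (c.mapCocone φ).IsColimit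

/-- An `ω^op`-diagram `K₀ ⟵ K₁ ⟵ K₂ ⟵ ⋯`. -/
structure OmegaOpDiagram (X : SSet.{u}) where
  obj : ℕ → X _⦋0⦌
  map : ∀ i, Edge (obj (i + 1)) (obj i)

/-- A cone `(K, {γ i : K ⟶ K i})` on an `ω^op`-diagram: `f i ∘ γ (i + 1) ≃ γ i` for all `i`. -/
structure OmegaOpCone {X : SSet.{u}} (D : OmegaOpDiagram X) where
  pt : X _⦋0⦌
  π : ∀ i, Edge pt (D.obj i)
  w : ∀ i, IsComp (π (i + 1)) (D.map i) (π i)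

/-- `h` is a mediating edge between the cones `c'` and `c`. -/
def OmegaOpCone.IsMediating {X : SSet.{u}} {D : OmegaOpDiagram X} (c c' : OmegaOpCone D)
    (h : Edge c'.pt c.pt) : Prop :=
  ∀ i, IsComp h (c.π i) (c'.π i)

/-- A cone is a limit if every cone has a mediating edge to it, which is unique up to homotopy. -/
def OmegaOpCone.IsLimit {X : SSet.{u}} {D : OmegaOpDiagram X} (c : OmegaOpCone D) : Prop :=
  ∀ c' : OmegaOpCone D, ∃ h : Edge c'.pt c.pt, c.IsMediating c' h ∧
    ∀ h' : Edge c'.pt c.pt, c.IsMediating c' h' → Homotopic h h'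

/-- Every `ω^op`-diagram has a limit. -/
def HasOmegaOpLimits (X : SSet.{u}) : Prop :=
  ∀ D : OmegaOpDiagram X, ∃ c : OmegaOpCone D, c.IsLimit

/-! ### `(0,∞)`-categories -/

/-- `s` is a least upper bound of the family `f i` with respect to the relation `r`. -/
def IsSupRel {α : Type*} (r : α → α → Prop) (f : ℕ → α) (s : α) : Prop :=
  (∀ i, r (f i) s) ∧ ∀ t, (∀ i, r (f i) t) → r s t

/-- A `(0,∞)`-category: a quasicategory whose mapping spaces carry a complete homotopy partial
order with a least element, such that composition is continuous and left strict. The vertices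
of the mapping space from `A` to `B` are the edges from `A` to `B`, and two of them are equivalent
when they are homotopic. -/
class ZeroInftyCategory (K : SSet.{u}) extends Quasicategory K where
  /-- The homotopy order `f ≾ g` on the mapping spaces. -/
  le : ∀ {A B : K _⦋0⦌}, Edge A B → Edge A B → Prop
  /-- The order contains the equivalences; in particular it is reflexive. -/
  le_of_homotopic : ∀ {A B : K _⦋0⦌} {f g : Edge A B}, Homotopic f g → le f g
  le_trans : ∀ {A B : K _⦋0⦌} {f g h : Edge A B}, le f g → le g h → le f h
  /-- The Cantor–Schröder–Bernstein property. -/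
  homotopic_of_le_of_le : ∀ {A B : K _⦋0⦌} {f g : Edge A B}, le f g → le g f → Homotopic f g
  /-- Every `ω`-chain has a supremum. -/
  exists_sup : ∀ {A B : K _⦋0⦌} (f : ℕ → Edge A B), (∀ i, le (f i) (f (i + 1))) →
    ∃ s : Edge A B, IsSupRel le f s
  /-- The least element of each mapping space. -/
  bot : ∀ A B : K _⦋0⦌, Edge A B
  bot_le : ∀ {A B : K _⦋0⦌} (f : Edge A B), le (bot A B) f
  /-- Composition is continuous: the composite of the suprema of two `ω`-chains is a supremum of
  the composites. -/
  comp_continuous : ∀ {A B C : K _⦋0⦌} (f : ℕ → Edge A B) (g : ℕ → Edge B C)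
    (h : ℕ → Edge A C) (s : Edge A B) (t : Edge B C) (r : Edge A C),
    (∀ i, le (f i) (f (i + 1))) → (∀ i, le (g i) (g (i + 1))) →
    IsSupRel le f s → IsSupRel le g t →
    (∀ i, IsComp (f i) (g i) (h i)) → IsComp s t r → IsSupRel le h r
  /-- `0_{B,C} ∘ f ≃ 0_{A,C}`. -/
  comp_bot : ∀ {A B C : K _⦋0⦌} (f : Edge A B), IsComp f (bot B C) (bot A C)

/-- The homotopy order on the edges from `A` to `B`. -/
def Le {K : SSet.{u}} [ZeroInftyCategory K] {A B : K _⦋0⦌} (f g : Edge A B) : Prop :=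
  ZeroInftyCategory.le f g

/-- `f` is an `ω`-chain for the homotopy order. -/
def IsOmegaChain {K : SSet.{u}} [ZeroInftyCategory K] {A B : K _⦋0⦌} (f : ℕ → Edge A B) : Prop :=
  ∀ i, Le (f i) (f (i + 1))

/-- `s` is a supremum of `f` for the homotopy order. -/
def IsSup {K : SSet.{u}} [ZeroInftyCategory K] {A B : K _⦋0⦌} (f : ℕ → Edge A B) (s : Edge A B) : Prop :=
  IsSupRel Le f s

lemma Le.refl {K : SSet.{u}} [ZeroInftyCategory K] {A B : K _⦋0⦌} (f : Edge A B) : Le f f :=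
  ZeroInftyCategory.le_of_homotopic ⟨CompStruct.compId f⟩

/-! ### `h`-projection pairs -/

/-- `(p, m)` is an `h`-projection pair from `A` to `B`: `p` followed by `m` is homotopic to the
identity of `A`, and `m` followed by `p` is below the identity of `B`. -/
def IsHProj {K : SSet.{u}} [ZeroInftyCategory K] {A B : K _⦋0⦌}
    (p : Edge A B) (m : Edge B A) : Prop :=
  IsComp p m (Edge.id A) ∧ ∃ e : Edge B B, IsComp m p e ∧ Le e (Edge.id B)

/-- The property of a `1`-simplex of `K × K^op` that it is `(p, m)` for an `h`-projection pair
`p : A ⟶ B`, `m : B ⟶ A` of `K`. -/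
def IsHProjSimplex {K : SSet.{u}} [ZeroInftyCategory K] (s : (K ⊗ K.op) _⦋1⦌) : Prop :=
  ∃ (A B : K _⦋0⦌) (p : Edge A B) (m : Edge B A),
    s = (pairEdge p (opEdge m)).edge ∧ IsHProj p m

/-- The simplicial set `K^HPrj`, as a subcomplex of `K × K^op`: an `n`-simplex is a pair
`(σ⁺, σ⁻)` of an `n`-simplex of `K` and an `n`-simplex of `K^op`, all of whose edges are
`h`-projection pairs (so that `σ⁺` and `σ⁻` have the same vertices). -/
def hPrj (K : SSet.{u}) [ZeroInftyCategory K] : (K ⊗ K.op).Subcomplex where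
  obj n := {s | ∀ f : n ⟶ Opposite.op ⦋1⦌, IsHProjSimplex ((K ⊗ K.op).map f s)}
  map {n m} g s hs f := by
    have := hs (g ≫ f)
    rwa [Functor.map_comp_apply] at this

/-! ### Locally continuous functors `K^op × K ⥤ K` and the functor they induce on `K^HPrj` -/

/-- The edge `F(f, g)` of `K`, for an edge `f : B ⟶ A` of `K`, i.e. `f : A ⟶ B` in `K^op`,
and an edge `g : C ⟶ D` of `K`. -/
def mapEdge {K : SSet.{u}} (F : K.op ⊗ K ⟶ K) {A B C D : K _⦋0⦌} (f : Edge B A) (g : Edge C D) :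
    Edge (F.app _ (opVertex A, C)) (F.app _ (opVertex B, D)) :=
  (pairEdge (opEdge f) g).map F

/-- A functor `F : K^op × K ⥤ K` is locally continuous if, for all `ω`-chains `f i` in
`K^op(A, B)` and `g i` in `K(C, D)`, with suprema `s` and `t`, the edge `F(s, t)` is a supremum
of the `F(f i, g i)`. -/
def IsLocallyContinuous {K : SSet.{u}} [ZeroInftyCategory K] (F : K.op ⊗ K ⟶ K) : Prop :=
  ∀ {A B C D : K _⦋0⦌} (f : ℕ → Edge B A) (g : ℕ → Edge C D) (s : Edge B A) (t : Edge C D),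
    IsOmegaChain f → IsOmegaChain g → IsSup f s → IsSup g t →
      IsSup (fun i ↦ mapEdge F (f i) (g i)) (mapEdge F s t)

/-- The map `(K × K^op) × (K × K^op) ⟶ K × K^op` sending `((σ⁺, σ⁻), (τ⁺, τ⁻))` to
`(F(σ⁻, τ⁺), F(σ⁺, τ⁻))`. -/
def biMap {K : SSet.{u}} (F : K.op ⊗ K ⟶ K) : (K ⊗ K.op) ⊗ (K ⊗ K.op) ⟶ K ⊗ K.op where
  app n := ↾fun x ↦ (F.app n (x.1.2, x.2.1),
    opObjEquiv.symm (F.app n (opObjEquiv.symm x.1.1, opObjEquiv x.2.2)))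
  naturality n m f := by
    ext ⟨⟨a, b⟩, ⟨c, d⟩⟩
    have h1 := NatTrans.naturality_apply F f ((b, c) : (K.op ⊗ K).obj n)
    have h2 := NatTrans.naturality_apply F (SimplexCategory.rev.map f.unop).op
      ((opObjEquiv.symm a, opObjEquiv d) : (K.op ⊗ K).obj _)
    refine Prod.ext ?_ ?_
    · exact h1
    · have h3 : K.op.map (SimplexCategory.rev.map f.unop).op (opObjEquiv.symm a) =
          opObjEquiv.symm (K.map f a) := by
        rw [op_map]
        exact congrArg (fun g ↦ K.map g a) (congrArg Quiver.Hom.op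
          (SimplexCategory.rev_map_rev_map f.unop))
      exact (congrArg (fun z ↦ opObjEquiv.symm (F.app m
        ((z, K.map (SimplexCategory.rev.map f.unop).op (opObjEquiv d)) : (K.op ⊗ K).obj m)))
          h3.symm).trans h2

lemma le_mapEdge {K : SSet.{u}} [ZeroInftyCategory K] {F : K.op ⊗ K ⟶ K}
    (hF : IsLocallyContinuous F) {A B C D : K _⦋0⦌}
    {f f' : Edge B A} {g g' : Edge C D} (hf : Le f f') (hg : Le g g') :
    Le (mapEdge F f g) (mapEdge F f' g') := by
  have key : ∀ {X Y : K _⦋0⦌} {u v : Edge X Y}, Le u v →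
      IsOmegaChain (fun i : ℕ ↦ if i = 0 then u else v) ∧
      IsSup (fun i : ℕ ↦ if i = 0 then u else v) v := by
    intro X Y u v h
    refine ⟨fun i ↦ ?_, fun i ↦ ?_, fun t ht ↦ by simpa using ht 1⟩
    · rcases i with _ | i
      · simpa using h
      · simpa using Le.refl v
    · rcases i with _ | i
      · simpa using h
      · simpa using Le.refl v
  simpa using (hF _ _ _ _ (key hf).1 (key hg).1 (key hf).2 (key hg).2).1 0

lemma isComp_mapEdge {K : SSet.{u}} (F : K.op ⊗ K ⟶ K) {A B C A' B' C' : K _⦋0⦌}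
    {f : Edge B A} {g : Edge C B} {h : Edge C A} (H : IsComp g f h)
    {f' : Edge A' B'} {g' : Edge B' C'} {h' : Edge A' C'} (H' : IsComp f' g' h') :
    IsComp (mapEdge F f f') (mapEdge F g g') (mapEdge F h h') := by
  obtain ⟨s⟩ := H
  obtain ⟨s'⟩ := H'
  have S : CompStruct (opEdge f) (opEdge g) (opEdge h) :=
    CompStruct.mk (X := K.op) (opObjEquiv.symm s.simplex)
      ((op_δ K 2 _).trans (congrArg opObjEquiv.symm s.d₀))
      ((op_δ K 0 _).trans (congrArg opObjEquiv.symm s.d₂))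
      ((op_δ K 1 _).trans (congrArg opObjEquiv.symm s.d₁))
  have T : CompStruct (pairEdge (opEdge f) f') (pairEdge (opEdge g) g')
      (pairEdge (opEdge h) h') :=
    CompStruct.mk (X := K.op ⊗ K) (S.simplex, s'.simplex)
      (Prod.ext S.d₂ s'.d₂) (Prod.ext S.d₀ s'.d₀) (Prod.ext S.d₁ s'.d₁)
  exact ⟨T.map F⟩

lemma mapEdge_id {K : SSet.{u}} (F : K.op ⊗ K ⟶ K) (A C : K _⦋0⦌) :
    mapEdge F (Edge.id A) (Edge.id C) = Edge.id _ := by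
  have h : pairEdge (opEdge (Edge.id A)) (Edge.id C) =
      Edge.id (X := K.op ⊗ K) (opVertex A, C) := by
    apply Edge.ext
    refine Prod.ext ?_ rfl
    exact (op_σ K 0 (opVertex A)).symm
  exact (congrArg (fun e ↦ Edge.map e F) h).trans (Edge.map_id (X := K.op ⊗ K) _ F)

lemma isHProj_mapEdge {K : SSet.{u}} [ZeroInftyCategory K] {F : K.op ⊗ K ⟶ K}
    (hF : IsLocallyContinuous F) {A B C D : K _⦋0⦌}
    {p : Edge A B} {m : Edge B A} {q : Edge C D} {n : Edge D C}
    (h : IsHProj p m) (h' : IsHProj q n) : IsHProj (mapEdge F m q) (mapEdge F p n) := by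
  obtain ⟨h₁, e, h₂, h₃⟩ := h
  obtain ⟨h₁', e', h₂', h₃'⟩ := h'
  refine ⟨?_, _, isComp_mapEdge F h₂ h₂', ?_⟩
  · rw [← mapEdge_id]
    exact isComp_mapEdge F h₁ h₁'
  · rw [← mapEdge_id]
    exact le_mapEdge hF h₃ h₃'

/-- The functor `F^{+-} : K^HPrj × K^HPrj ⥤ K^HPrj` induced by a locally continuous functor
`F : K^op × K ⥤ K`: it sends a pair of simplices `((σ⁺, σ⁻), (τ⁺, τ⁻))` to
`(F(σ⁻, τ⁺), F(σ⁺, τ⁻))`. -/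
def hPrjFunctor {K : SSet.{u}} [ZeroInftyCategory K]
    (F : K.op ⊗ K ⟶ K) (hF : IsLocallyContinuous F) :
    (hPrj K : SSet.{u}) ⊗ (hPrj K : SSet.{u}) ⟶ (hPrj K : SSet.{u}) :=
  Subcomplex.lift (((hPrj K).ι ⊗ₘ (hPrj K).ι) ≫ biMap F) (by
    rintro n _ ⟨⟨s, t⟩, rfl⟩ f
    have h := NatTrans.naturality_apply (biMap F) f
      ((s.1, t.1) : ((K ⊗ K.op) ⊗ (K ⊗ K.op)).obj n)
    obtain ⟨A, B, p, m, hs, hpm⟩ := s.2 f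
    obtain ⟨C, D, q, r, ht, hqr⟩ := t.2 f
    refine ⟨_, _, _, _, ?_, isHProj_mapEdge hF hpm hqr⟩
    refine h.symm.trans ?_
    exact (congrArg₂ (fun a b ↦ (biMap F).app (Opposite.op ⦋1⦌) (a, b)) hs ht).trans rfl)

end HomotopyDomain

/-! Composites, homotopies and the order `≾` depend only on homotopy classes of edges, so the whole
statement can be read in the homotopy category of `K`. There the hom-sets are partially ordered with
suprema of `ω`-chains, composition is continuous, and sequential limits exist
(`hasSequentialLimits_hoCat`). Edges of `hPrj K` up to homotopy become ordinary projection pairs,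
and colimits of `ω`-diagrams become colimits for the latter (`isColimit_iff`).

The core is the limit-colimit coincidence for projection pairs: a cocone is a colimit if and only if
it is exhaustive, i.e. its idempotents `proj ≫ emb` have supremum the identity. If it is exhaustive,
the mediating pair is a supremum of composites through the stages (`IsExhaustive.isColimit`).
Conversely, the limit of the projections carries an exhaustive cocone (`exists_isExhaustive`), and
every colimit cocone is isomorphic to it (`IsColimit.isExhaustive`).

Exhaustiveness is a statement about suprema, hence survives a locally continuous functor: the
idempotents of the image cocone are the values of `F` on pairs of idempotents, and their supremum is
`F(id, id) = id` (`isLUB_hPrjFunctor`). A colimit in the product first yields a colimit in each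
factor (`isColimit_mapCocone_fst`, `isColimit_mapCocone_snd`). -/

namespace HomotopyDomain

open SSet SSet.Edge

/-! ### The homotopy category of a quasicategory -/

section HomotopyCategory

variable {X : SSet.{u}}

lemma exists_filler [Quasicategory X] {n : ℕ} {i : Fin (n + 3)} (h₀ : 0 < i)
    (hn : i < Fin.last (n + 2)) (φ : (Λ[n + 2, i] : SSet.{u}) ⟶ X) :
    ∃ σ : X _⦋n + 2⦌, ∀ (j : Fin (n + 3)) (hj : j ≠ i),
      yonedaEquiv.symm (X.δ j σ) = horn.ι i j hj ≫ φ := by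
  obtain ⟨σ, rfl⟩ := Quasicategory.hornFilling h₀ hn φ
  refine ⟨yonedaEquiv σ, fun j hj ↦ ?_⟩
  rw [horn.ι_ι_assoc, ← stdSimplex.yonedaEquiv_δ_comp, Equiv.symm_apply_apply]

lemma exists_compStruct [Quasicategory X] {x₀ x₁ x₂ : X _⦋0⦌} (f : Edge x₀ x₁) (g : Edge x₁ x₂) :
    Nonempty (Σ h : Edge x₀ x₂, CompStruct f g h) := by
  have w : stdSimplex.{u}.δ (0 : Fin 2) ≫ yonedaEquiv.symm f.edge =
      stdSimplex.δ (1 : Fin 2) ≫ yonedaEquiv.symm g.edge := by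
    simp only [stdSimplex.δ_comp_yonedaEquiv_symm, f.tgt_eq, g.src_eq]
  obtain ⟨σ, hσ⟩ := exists_filler (n := 0) (i := 1) (by decide) (by decide)
    (horn₂₁.isPushout.desc (yonedaEquiv.symm f.edge) (yonedaEquiv.symm g.edge) w)
  have h₂ : X.δ 2 σ = f.edge := yonedaEquiv.symm.injective
    ((hσ 2 (by decide)).trans (horn₂₁.isPushout.inl_desc _ _ w))
  have h₀ : X.δ 0 σ = g.edge := yonedaEquiv.symm.injective
    ((hσ 0 (by decide)).trans (horn₂₁.isPushout.inr_desc _ _ w))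
  have src : X.δ 1 (X.δ 1 σ) = x₀ := by
    rw [← f.src_eq, ← h₂]
    exact (X.δ_comp_δ_apply (i := 1) (j := 1) le_rfl σ).symm
  have tgt : X.δ 0 (X.δ 1 σ) = x₂ := by
    rw [← g.tgt_eq, ← h₀]
    exact X.δ_comp_δ_apply (i := 0) (j := 0) le_rfl σ
  exact ⟨Edge.mk (X.δ 1 σ) src tgt, CompStruct.mk σ h₂ h₀ rfl⟩

variable {x₀ x₁ x₂ x₃ : X _⦋0⦌} {e₀₁ : Edge x₀ x₁} {e₁₂ : Edge x₁ x₂} {e₂₃ : Edge x₂ x₃}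
  {e₀₂ : Edge x₀ x₂} {e₁₃ : Edge x₁ x₃} {e₀₃ : Edge x₀ x₃}

/-- The three given triangles form a horn `Λ[3, 1]`; the missing face of a filler is the required
triangle. This is one half of associativity up to homotopy, and `compStruct_fill₃₂` is the other. -/
lemma compStruct_fill₃₁ [Quasicategory X] (f₃ : CompStruct e₀₁ e₁₂ e₀₂)
    (f₀ : CompStruct e₁₂ e₂₃ e₁₃) (f₂ : CompStruct e₀₁ e₁₃ e₀₃) :
    Nonempty (CompStruct e₀₂ e₂₃ e₀₃) := by
  obtain ⟨φ, h₀, h₂, h₃⟩ := horn₃₁.exists_desc (yonedaEquiv.symm f₀.simplex)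
    (yonedaEquiv.symm f₂.simplex) (yonedaEquiv.symm f₃.simplex)
    (by simp only [stdSimplex.δ_comp_yonedaEquiv_symm, CompStruct.d₂, CompStruct.d₀])
    (by simp only [stdSimplex.δ_comp_yonedaEquiv_symm, CompStruct.d₁, CompStruct.d₀])
    (by simp only [stdSimplex.δ_comp_yonedaEquiv_symm, CompStruct.d₂])
  obtain ⟨σ, hσ⟩ := exists_filler (n := 1) (i := 1) (by decide) (by decide) φ
  have h₀ : X.δ 0 σ = f₀.simplex := yonedaEquiv.symm.injective ((hσ 0 (by decide)).trans h₀)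
  have h₂ : X.δ 2 σ = f₂.simplex := yonedaEquiv.symm.injective ((hσ 2 (by decide)).trans h₂)
  have h₃ : X.δ 3 σ = f₃.simplex := yonedaEquiv.symm.injective ((hσ 3 (by decide)).trans h₃)
  refine ⟨CompStruct.mk (X.δ 1 σ) ?_ ?_ ?_⟩
  · rw [← f₃.d₁, ← h₃]
    exact (X.δ_comp_δ_apply (i := 1) (j := 2) (by decide) σ).symm
  · rw [← f₀.d₀, ← h₀]
    exact X.δ_comp_δ_apply (i := 0) (j := 0) (by decide) σ
  · rw [← f₂.d₁, ← h₂]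
    exact (X.δ_comp_δ_apply (i := 1) (j := 1) (by decide) σ).symm

lemma compStruct_fill₃₂ [Quasicategory X] (f₃ : CompStruct e₀₁ e₁₂ e₀₂)
    (f₀ : CompStruct e₁₂ e₂₃ e₁₃) (f₁ : CompStruct e₀₂ e₂₃ e₀₃) :
    Nonempty (CompStruct e₀₁ e₁₃ e₀₃) := by
  obtain ⟨φ, h₀, h₁, h₃⟩ := horn₃₂.exists_desc (yonedaEquiv.symm f₀.simplex)
    (yonedaEquiv.symm f₁.simplex) (yonedaEquiv.symm f₃.simplex)
    (by simp only [stdSimplex.δ_comp_yonedaEquiv_symm, CompStruct.d₂, CompStruct.d₁])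
    (by simp only [stdSimplex.δ_comp_yonedaEquiv_symm, CompStruct.d₂, CompStruct.d₀])
    (by simp only [stdSimplex.δ_comp_yonedaEquiv_symm, CompStruct.d₀])
  obtain ⟨σ, hσ⟩ := exists_filler (n := 1) (i := 2) (by decide) (by decide) φ
  have h₀ : X.δ 0 σ = f₀.simplex := yonedaEquiv.symm.injective ((hσ 0 (by decide)).trans h₀)
  have h₁ : X.δ 1 σ = f₁.simplex := yonedaEquiv.symm.injective ((hσ 1 (by decide)).trans h₁)
  have h₃ : X.δ 3 σ = f₃.simplex := yonedaEquiv.symm.injective ((hσ 3 (by decide)).trans h₃)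
  refine ⟨CompStruct.mk (X.δ 2 σ) ?_ ?_ ?_⟩
  · rw [← f₃.d₂, ← h₃]
    exact (X.δ_comp_δ_apply (i := 2) (j := 2) (by decide) σ).symm
  · rw [← f₀.d₁, ← h₀]
    exact X.δ_comp_δ_apply (i := 0) (j := 1) (by decide) σ
  · rw [← f₁.d₁, ← h₁]
    exact X.δ_comp_δ_apply (i := 1) (j := 1) (by decide) σ

instance quasicategory₂_truncation [Quasicategory X] :
    Truncated.Quasicategory₂ ((truncation 2).obj X) where
  fill21 f g := exists_compStruct (X := X) f g
  fill31 f₃ f₀ f₂ := compStruct_fill₃₁ (X := X) f₃ f₀ f₂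
  fill32 f₃ f₀ f₁ := compStruct_fill₃₂ (X := X) f₃ f₀ f₁

/-- The homotopy category of a quasicategory. -/
abbrev HoCat (X : SSet.{u}) [Quasicategory X] : Type u :=
  Truncated.HomotopyCategory₂ ((truncation 2).obj X)

variable [Quasicategory X]

/-- A vertex of a quasicategory, as an object of the homotopy category. -/
abbrev hoObj (x : X _⦋0⦌) : HoCat X := .mk x

/-- The homotopy class of an edge. -/
def hoMap {x y : X _⦋0⦌} (f : Edge x y) : hoObj x ⟶ hoObj y :=
  Truncated.HomotopyCategory₂.homMk f.toTruncated

lemma hoMap_surjective {x y : X _⦋0⦌} :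
    Function.Surjective (hoMap : Edge x y → (hoObj x ⟶ hoObj y)) :=
  Truncated.HomotopyCategory₂.homMk_surjective

@[simp]
lemma hoMap_id (x : X _⦋0⦌) : hoMap (Edge.id x) = 𝟙 (hoObj x) := rfl

/-- The dictionary for everything below: existence of a `2`-simplex becomes an equation between
morphisms. -/
lemma isComp_iff {x y z : X _⦋0⦌} {f : Edge x y} {g : Edge y z} {h : Edge x z} :
    IsComp f g h ↔ hoMap f ≫ hoMap g = hoMap h :=
  Truncated.Edge.CompStruct.nonempty_iff

lemma homotopic_iff {x y : X _⦋0⦌} {f g : Edge x y} : Homotopic f g ↔ hoMap f = hoMap g :=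
  isComp_iff.trans (by simp)

end HomotopyCategory

/-! ### Projection pairs in order-enriched categories -/

section OmegaOrdered

/-- A category enriched in partial orders with suprema of `ω`-chains, in which composition
is continuous. -/
class OmegaOrderedCategory (C : Type*) [Category* C] [∀ A B : C, PartialOrder (A ⟶ B)] : Prop where
  exists_isLUB : ∀ {A B : C} (f : ℕ → (A ⟶ B)), Monotone f → ∃ s, IsLUB (Set.range f) s
  isLUB_comp : ∀ {A B D : C} {f : ℕ → (A ⟶ B)} {g : ℕ → (B ⟶ D)} {s : A ⟶ B} {t : B ⟶ D},
    Monotone f → Monotone g → IsLUB (Set.range f) s → IsLUB (Set.range g) t →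
    IsLUB (Set.range fun i ↦ f i ≫ g i) (s ≫ t)

variable {C : Type*} [Category* C] [∀ A B : C, PartialOrder (A ⟶ B)]

/-- A projection pair from `A` to `B`. -/
@[ext]
structure ProjPair (A B : C) where
  emb : A ⟶ B
  proj : B ⟶ A
  emb_proj : emb ≫ proj = 𝟙 A
  proj_emb : proj ≫ emb ≤ 𝟙 B

lemma ProjPair.emb_proj_assoc {A B D : C} (f : ProjPair A B) (k : A ⟶ D) :
    f.emb ≫ f.proj ≫ k = k := by
  rw [← Category.assoc, f.emb_proj, Category.id_comp]

variable [OmegaOrderedCategory C]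

lemma isLUB_const {P : Type*} [Preorder P] (a : P) : IsLUB (Set.range fun _ : ℕ ↦ a) a := by
  simp [isLUB_singleton]

lemma isLUB_of_le_of_forall_ge {P : Type*} [Preorder P] {f : ℕ → P} (hf : Monotone f) {a : P}
    (j : ℕ) (h : ∀ i, j ≤ i → f i = a) : IsLUB (Set.range f) a := by
  refine ⟨?_, fun b hb ↦ h j le_rfl ▸ hb ⟨j, rfl⟩⟩
  rintro _ ⟨i, rfl⟩
  exact (hf (le_max_left i j)).trans (h _ (le_max_right i j)).le

/-- Continuity implies monotonicity: apply it to the chains `u ≤ v ≤ v ≤ ⋯`, whose supremum is `v`.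
-/
lemma comp_le_comp {A B D : C} {f f' : A ⟶ B} {g g' : B ⟶ D} (hf : f ≤ f') (hg : g ≤ g') :
    f ≫ g ≤ f' ≫ g' := by
  have key : ∀ {X Y : C} {u v : X ⟶ Y}, u ≤ v →
      Monotone (fun i : ℕ ↦ if i = 0 then u else v) ∧
      IsLUB (Set.range fun i : ℕ ↦ if i = 0 then u else v) v := by
    intro X Y u v h
    have hm : Monotone (fun i : ℕ ↦ if i = 0 then u else v) :=
      monotone_nat_of_le_succ fun i ↦ by rcases i with _ | i <;> simp [h]
    exact ⟨hm, isLUB_of_le_of_forall_ge hm 1 fun i hi ↦ if_neg (by lia)⟩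
  simpa using (OmegaOrderedCategory.isLUB_comp (key hf).1 (key hg).1 (key hf).2 (key hg).2).1
    ⟨0, rfl⟩

lemma isLUB_comp_left {A B D : C} {f : ℕ → (A ⟶ B)} {s : A ⟶ B} (hf : Monotone f)
    (hs : IsLUB (Set.range f) s) (t : B ⟶ D) : IsLUB (Set.range fun i ↦ f i ≫ t) (s ≫ t) :=
  OmegaOrderedCategory.isLUB_comp hf monotone_const hs (isLUB_const t)

lemma isLUB_comp_right {A B D : C} {f : ℕ → (B ⟶ D)} {s : B ⟶ D} (hf : Monotone f)
    (hs : IsLUB (Set.range f) s) (t : A ⟶ B) : IsLUB (Set.range fun i ↦ t ≫ f i) (t ≫ s) :=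
  OmegaOrderedCategory.isLUB_comp monotone_const hf (isLUB_const t) hs

namespace ProjPair

/-- The identity projection pair. -/
@[simps]
def id (A : C) : ProjPair A A where
  emb := 𝟙 A
  proj := 𝟙 A
  emb_proj := Category.id_comp _
  proj_emb := (Category.id_comp _).le

/-- The composition of projection pairs. -/
@[simps]
def comp {A B D : C} (f : ProjPair A B) (g : ProjPair B D) : ProjPair A D where
  emb := f.emb ≫ g.emb
  proj := g.proj ≫ f.proj
  emb_proj := by rw [Category.assoc, g.emb_proj_assoc, f.emb_proj]
  proj_emb := by
    have := comp_le_comp (comp_le_comp (le_refl g.proj) f.proj_emb) (le_refl g.emb)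
    rw [Category.comp_id] at this
    simpa using this.trans g.proj_emb

end ProjPair

/-- A cocone of projection pairs on a sequence of projection pairs. -/
structure ProjCocone {A : ℕ → C} (P : ∀ i, ProjPair (A i) (A (i + 1))) where
  pt : C
  ι : ∀ i, ProjPair (A i) pt
  w_emb : ∀ i, (P i).emb ≫ (ι (i + 1)).emb = (ι i).emb
  w_proj : ∀ i, (ι (i + 1)).proj ≫ (P i).proj = (ι i).proj

namespace ProjCocone

variable {A : ℕ → C} {P : ∀ i, ProjPair (A i) (A (i + 1))}

/-- `h` is a mediating projection pair between the cocones `c` and `c'`. -/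
def IsMediating (c c' : ProjCocone P) (h : ProjPair c.pt c'.pt) : Prop :=
  ∀ i, (c.ι i).emb ≫ h.emb = (c'.ι i).emb ∧ h.proj ≫ (c.ι i).proj = (c'.ι i).proj

/-- A cocone of projection pairs is a colimit if there is a unique mediating projection pair
from it to any other cocone. -/
def IsColimit (c : ProjCocone P) : Prop :=
  ∀ c' : ProjCocone P, ∃! h : ProjPair c.pt c'.pt, c.IsMediating c' h

/-- The approximations of the identity of the vertex of a cocone of projection pairs exhaust it. -/
def IsExhaustive (c : ProjCocone P) : Prop :=
  IsLUB (Set.range fun i ↦ (c.ι i).proj ≫ (c.ι i).emb) (𝟙 c.pt)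

/-- Stage `i` is stage `i + 1` with `(P i).proj ≫ (P i).emb ≤ 𝟙` inserted in the middle. Two cocones
are allowed because mediating morphisms are suprema of such mixed composites. -/
lemma monotone_proj_emb (c c' : ProjCocone P) :
    Monotone fun i ↦ (c.ι i).proj ≫ (c'.ι i).emb := by
  refine monotone_nat_of_le_succ fun i ↦ ?_
  have := comp_le_comp (comp_le_comp (le_refl (c.ι (i + 1)).proj) (P i).proj_emb)
    (le_refl (c'.ι (i + 1)).emb)
  rw [Category.comp_id] at this
  rwa [← c.w_proj, ← c'.w_emb, Category.assoc, ← Category.assoc (P i).proj, ← Category.assoc]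

/-- The transition maps of a sequence of embeddings. -/
def up (P : ∀ i, ProjPair (A i) (A (i + 1))) (i : ℕ) {j : ℕ} (h : i ≤ j) : ProjPair (A i) (A j) :=
  Nat.leRec (motive := fun j _ ↦ ProjPair (A i) (A j)) (ProjPair.id _) (fun j _ f ↦ f.comp (P j)) h

lemma up_self (i : ℕ) : up P i le_rfl = ProjPair.id (A i) := Nat.leRec_self _ _

lemma up_succ {i j : ℕ} (h : i ≤ j) : up P i (h.trans j.le_succ) = (up P i h).comp (P j) :=
  Nat.leRec_succ _ _ h

lemma up_succ_left {i j : ℕ} (h : i + 1 ≤ j) :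
    up P i (i.le_succ.trans h) = (P i).comp (up P (i + 1) h) := by
  induction j, h using Nat.le_induction with
  | base =>
    rw [up_succ le_rfl, up_self, up_self]
    ext <;> simp
  | succ j h ih =>
    rw [up_succ (i.le_succ.trans h), ih, up_succ h]
    ext <;> simp

lemma up_emb (c : ProjCocone P) {i j : ℕ} (h : i ≤ j) :
    (up P i h).emb ≫ (c.ι j).emb = (c.ι i).emb := by
  induction j, h using Nat.le_induction with
  | base => simp [up_self]
  | succ j h ih => rw [up_succ h, ProjPair.comp_emb, Category.assoc, c.w_emb, ih]

lemma up_proj (c : ProjCocone P) {i j : ℕ} (h : i ≤ j) :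
    (c.ι j).proj ≫ (up P i h).proj = (c.ι i).proj := by
  induction j, h using Nat.le_induction with
  | base => simp [up_self]
  | succ j h ih => rw [up_succ h, ProjPair.comp_proj, ← Category.assoc, c.w_proj, ih]

/-- Moving up from `i` to `n` and then down to `j`. -/
def zigzag (P : ∀ i, ProjPair (A i) (A (i + 1))) (i j : ℕ) : A i ⟶ A j :=
  (up P i (le_max_left i j)).emb ≫ (up P j (le_max_right i j)).proj

/-- The height of the detour is irrelevant: each extra step up is cancelled by the step down, as
`emb ≫ proj = 𝟙`. -/
lemma zigzag_eq {i j n : ℕ} (hi : i ≤ n) (hj : j ≤ n) :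
    (up P i hi).emb ≫ (up P j hj).proj = zigzag P i j := by
  have hn : max i j ≤ n := max_le hi hj
  induction n, hn using Nat.le_induction with
  | base => rfl
  | succ n hn ih =>
    have hi' := (le_max_left i j).trans hn
    have hj' := (le_max_right i j).trans hn
    rw [up_succ hi', up_succ hj', ProjPair.comp_emb, ProjPair.comp_proj, Category.assoc,
      ProjPair.emb_proj_assoc, ih hi' hj']

lemma zigzag_comp_proj (i j : ℕ) : zigzag P i (j + 1) ≫ (P j).proj = zigzag P i j := by
  have h := le_max_right i (j + 1)
  rw [← zigzag_eq (le_max_left i (j + 1)) h, ← zigzag_eq (le_max_left i (j + 1))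
    (j.le_succ.trans h), up_succ_left h, Category.assoc, ProjPair.comp_proj]

lemma emb_comp_zigzag (i j : ℕ) : (P i).emb ≫ zigzag P (i + 1) j = zigzag P i j := by
  have h := le_max_left (i + 1) j
  rw [← zigzag_eq h (le_max_right (i + 1) j), ← zigzag_eq (i.le_succ.trans h)
    (le_max_right (i + 1) j), up_succ_left h, ProjPair.comp_emb, Category.assoc]

lemma zigzag_self (i : ℕ) : zigzag P i i = 𝟙 (A i) := by
  rw [← zigzag_eq le_rfl le_rfl, up_self]
  simp

lemma zigzag_of_ge {i j : ℕ} (h : j ≤ i) : zigzag P i j = (up P j h).proj := by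
  rw [← zigzag_eq le_rfl h, up_self]
  simp

end ProjCocone

/-- Limits of sequences `A 0 ⟵ A 1 ⟵ ⋯` exist. -/
def HasSequentialLimits (C : Type*) [Category* C] : Prop :=
  ∀ (A : ℕ → C) (m : ∀ i, A (i + 1) ⟶ A i), ∃ (L : C) (π : ∀ i, L ⟶ A i),
    (∀ i, π (i + 1) ≫ m i = π i) ∧ ∀ (B : C) (ρ : ∀ i, B ⟶ A i),
      (∀ i, ρ (i + 1) ≫ m i = ρ i) → ∃! h : B ⟶ L, ∀ i, h ≫ π i = ρ i

/-! ### Colimit cocones are the exhaustive ones -/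

namespace ProjCocone

variable {A : ℕ → C} {P : ∀ i, ProjPair (A i) (A (i + 1))}

/-- The limit of the sequence of projections carries an exhaustive cocone. -/
lemma exists_isExhaustive (hC : HasSequentialLimits C) (P : ∀ i, ProjPair (A i) (A (i + 1))) :
    ∃ c : ProjCocone P, c.IsExhaustive := by
  obtain ⟨L, π, hπ, hL⟩ := hC A fun i ↦ (P i).proj
  have ext : ∀ {B : C} {f g : B ⟶ L}, (∀ i, f ≫ π i = g ≫ π i) → f = g := fun {B f g} h ↦
    (hL B (fun i ↦ g ≫ π i) fun i ↦ by rw [Category.assoc, hπ]).unique h fun _ ↦ rfl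
  -- The embedding of stage `i` into the limit has the zigzags out of `A i` as its components.
  choose e he _ using fun i ↦ hL (A i) (zigzag P i) (zigzag_comp_proj i)
  have w : ∀ i, (P i).emb ≫ e (i + 1) = e i := fun i ↦ ext fun j ↦ by
    rw [Category.assoc, he, he, emb_comp_zigzag]
  have mono : Monotone fun i ↦ π i ≫ e i := monotone_nat_of_le_succ fun i ↦ by
    have := comp_le_comp (comp_le_comp (le_refl (π (i + 1))) (P i).proj_emb) (le_refl (e (i + 1)))
    rw [Category.comp_id] at this
    rwa [← hπ, ← w, Category.assoc, ← Category.assoc (P i).proj, ← Category.assoc]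
  have down : ∀ {i j : ℕ} (h : j ≤ i), π i ≫ (up P j h).proj = π j := by
    intro i j h
    induction i, h using Nat.le_induction with
    | base => simp [up_self]
    | succ i h ih => rw [up_succ h, ProjPair.comp_proj, ← Category.assoc, hπ, ih]
  obtain ⟨s, hs⟩ := OmegaOrderedCategory.exists_isLUB _ mono
  -- It suffices to compare after `π j`: for `i ≥ j` the composite `π i ≫ e i ≫ π j` already equals
  -- `π j`, so the chain is eventually constant.
  have hs_id : s = 𝟙 L := ext fun j ↦ by
    have mono' : Monotone fun i ↦ (π i ≫ e i) ≫ π j := fun a b h ↦ comp_le_comp (mono h) le_rfl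
    refine (isLUB_comp_left mono hs (π j)).unique ?_
    rw [Category.id_comp]
    exact isLUB_of_le_of_forall_ge mono' j fun i hi ↦ by
      rw [Category.assoc, he, zigzag_of_ge hi, down hi]
  subst hs_id
  exact ⟨{ pt := L
           ι i := ⟨e i, π i, by rw [he, zigzag_self], hs.1 ⟨i, rfl⟩⟩
           w_emb := w
           w_proj := hπ }, hs⟩

/-- An exhaustive cocone of projection pairs is a colimit. -/
lemma IsExhaustive.isColimit {c : ProjCocone P} (hc : c.IsExhaustive) : c.IsColimit := by
  intro c'
  have mono := c.monotone_proj_emb c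
  obtain ⟨p, hp⟩ := OmegaOrderedCategory.exists_isLUB _ (c.monotone_proj_emb c')
  obtain ⟨m, hm⟩ := OmegaOrderedCategory.exists_isLUB _ (c'.monotone_proj_emb c)
  have emb : ∀ {D D' : ProjCocone P} {q : D.pt ⟶ D'.pt},
      IsLUB (Set.range fun i ↦ (D.ι i).proj ≫ (D'.ι i).emb) q → ∀ j,
      (D.ι j).emb ≫ q = (D'.ι j).emb := by
    intro D D' q hq j
    have mono' := D.monotone_proj_emb D'
    refine (isLUB_comp_right mono' hq (D.ι j).emb).unique ?_
    refine isLUB_of_le_of_forall_ge (fun a b h ↦ comp_le_comp le_rfl (mono' h)) j fun i hi ↦ ?_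
    rw [← D.up_emb hi, Category.assoc, ProjPair.emb_proj_assoc, D'.up_emb]
  have proj : ∀ {D D' : ProjCocone P} {q : D.pt ⟶ D'.pt},
      IsLUB (Set.range fun i ↦ (D.ι i).proj ≫ (D'.ι i).emb) q → ∀ j,
      q ≫ (D'.ι j).proj = (D.ι j).proj := by
    intro D D' q hq j
    have mono' := D.monotone_proj_emb D'
    refine (isLUB_comp_left mono' hq (D'.ι j).proj).unique ?_
    refine isLUB_of_le_of_forall_ge (fun a b h ↦ comp_le_comp (mono' h) le_rfl) j fun i hi ↦ ?_
    rw [← D'.up_proj hi, Category.assoc, ProjPair.emb_proj_assoc, D.up_proj]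
  refine ⟨⟨p, m, ?_, ?_⟩, fun i ↦ ⟨emb hp i, proj hm i⟩, ?_⟩
  -- By continuity `p ≫ m` is the supremum of the idempotents of `c`, which is the identity by
  -- exhaustiveness. In the other order the idempotents of `c'` appear, and these are only bounded
  -- by the identity.
  · refine (OmegaOrderedCategory.isLUB_comp (c.monotone_proj_emb c') (c'.monotone_proj_emb c)
      hp hm).unique ?_
    simp only [Category.assoc, ProjPair.emb_proj_assoc]
    exact hc
  · refine (OmegaOrderedCategory.isLUB_comp (c'.monotone_proj_emb c) (c.monotone_proj_emb c')
      hm hp).2 ?_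
    rintro _ ⟨i, rfl⟩
    simpa only [Category.assoc, ProjPair.emb_proj_assoc] using (c'.ι i).proj_emb
  · rintro ⟨p', m', _, _⟩ h'
    -- Precomposing `p'` with the identity, written as a supremum of idempotents of `c`, exhibits
    -- `p'` as the supremum defining `p`; dually for `m'`.
    have hp' := isLUB_comp_left mono hc p'
    have hm' := isLUB_comp_right mono hc m'
    have e₁ : ∀ i, (c.ι i).emb ≫ p' = (c'.ι i).emb := fun i ↦ (h' i).1
    have e₂ : ∀ i, m' ≫ (c.ι i).proj = (c'.ι i).proj := fun i ↦ (h' i).2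
    simp only [Category.assoc, e₁, Category.id_comp] at hp'
    simp only [← Category.assoc, e₂, Category.comp_id] at hm'
    exact ProjPair.ext (hp'.unique hp) (hm'.unique hm)

/-- A colimit cocone of projection pairs is exhaustive, if limits of sequences exist. -/
lemma IsColimit.isExhaustive (hC : HasSequentialLimits C) {c : ProjCocone P} (hc : c.IsColimit) :
    c.IsExhaustive := by
  obtain ⟨d, hd⟩ := exists_isExhaustive hC P
  obtain ⟨k, hk, -⟩ := hc d
  obtain ⟨l, hl, -⟩ := hd.isColimit c
  have hkl : k.comp l = ProjPair.id c.pt := by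
    refine (hc c).unique (fun i ↦ ⟨?_, ?_⟩) fun i ↦ ⟨Category.comp_id _, Category.id_comp _⟩
    · rw [ProjPair.comp_emb, ← Category.assoc, (hk i).1, (hl i).1]
    · rw [ProjPair.comp_proj, Category.assoc, (hk i).2, (hl i).2]
  have h₁ : k.emb ≫ l.emb = 𝟙 _ := congrArg ProjPair.emb hkl
  -- `k.emb` is a left inverse of `l.emb` and `l.proj` a right inverse, in diagrammatic order, so
  -- they agree. Hence `l.proj ≫ l.emb = 𝟙`, and conjugating the idempotents of `d` by `l`
  -- transports exhaustiveness to `c`.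
  have h₂ : l.proj = k.emb := by
    rw [← Category.id_comp l.proj, ← h₁, Category.assoc, l.emb_proj, Category.comp_id]
  have hlub := isLUB_comp_left (fun a b h ↦ comp_le_comp le_rfl (d.monotone_proj_emb d h))
    (isLUB_comp_right (d.monotone_proj_emb d) hd l.proj) l.emb
  have hid : (l.proj ≫ 𝟙 _) ≫ l.emb = 𝟙 _ := by rw [Category.comp_id, h₂, h₁]
  rw [hid] at hlub
  have : ∀ i, (l.proj ≫ (d.ι i).proj ≫ (d.ι i).emb) ≫ l.emb = (c.ι i).proj ≫ (c.ι i).emb :=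
    fun i ↦ by rw [← (hl i).1, ← (hl i).2, Category.assoc, Category.assoc, Category.assoc]
  simpa only [IsExhaustive, this] using hlub

end ProjCocone

end OmegaOrdered

/-! ### The order on the homotopy category of a `(0,∞)`-category -/

section ZeroInfty

variable {K : SSet.{u}} [ZeroInftyCategory K]

lemma le_congr {A B : K _⦋0⦌} {f f' g g' : Edge A B} (hf : hoMap f = hoMap f')
    (hg : hoMap g = hoMap g') (h : Le f g) : Le f' g' :=
  ZeroInftyCategory.le_trans (ZeroInftyCategory.le_of_homotopic (homotopic_iff.2 hf.symm))
    (ZeroInftyCategory.le_trans h (ZeroInftyCategory.le_of_homotopic (homotopic_iff.2 hg)))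

/-- Comparing some pair of representatives amounts to comparing all of them, by `le_congr`.
Antisymmetry is the Cantor–Schröder–Bernstein axiom. -/
instance hoPartialOrder (A B : HoCat K) : PartialOrder (A ⟶ B) where
  le a b := ∃ f g : Edge (X := K) A.pt B.pt, hoMap f = a ∧ hoMap g = b ∧ Le f g
  le_refl a := by
    obtain ⟨f, rfl⟩ := hoMap_surjective a
    exact ⟨f, f, rfl, rfl, Le.refl f⟩
  le_trans a b c := by
    rintro ⟨f, g, rfl, rfl, h⟩ ⟨g', k, hg, rfl, h'⟩
    exact ⟨f, k, rfl, rfl, ZeroInftyCategory.le_trans h (le_congr hg rfl h')⟩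
  le_antisymm a b := by
    rintro ⟨f, g, rfl, rfl, h⟩ ⟨g', f', hg, hf, h'⟩
    exact homotopic_iff.1 (ZeroInftyCategory.homotopic_of_le_of_le h (le_congr hg hf h'))

lemma hoMap_le_iff {A B : K _⦋0⦌} {f g : Edge A B} : hoMap f ≤ hoMap g ↔ Le f g :=
  ⟨fun ⟨_, _, hf, hg, h⟩ ↦ le_congr hf hg h, fun h ↦ ⟨f, g, rfl, rfl, h⟩⟩

lemma isOmegaChain_iff {A B : K _⦋0⦌} {f : ℕ → Edge A B} :
    IsOmegaChain f ↔ Monotone fun i ↦ hoMap (f i) :=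
  ⟨fun h ↦ monotone_nat_of_le_succ fun i ↦ hoMap_le_iff.2 (h i),
    fun h i ↦ hoMap_le_iff.1 (h i.le_succ)⟩

lemma isSup_iff {A B : K _⦋0⦌} {f : ℕ → Edge A B} {s : Edge A B} :
    IsSup f s ↔ IsLUB (Set.range fun i ↦ hoMap (f i)) (hoMap s) := by
  refine ⟨fun h ↦ ⟨?_, fun t ht ↦ ?_⟩, fun h ↦ ⟨fun i ↦ hoMap_le_iff.1 (h.1 ⟨i, rfl⟩),
    fun t ht ↦ hoMap_le_iff.1 (h.2 ?_)⟩⟩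
  · rintro _ ⟨i, rfl⟩
    exact hoMap_le_iff.2 (h.1 i)
  · obtain ⟨t, rfl⟩ := hoMap_surjective t
    exact hoMap_le_iff.2 (h.2 t fun i ↦ hoMap_le_iff.1 (ht ⟨i, rfl⟩))
  · rintro _ ⟨i, rfl⟩
    exact hoMap_le_iff.2 (ht i)

instance : OmegaOrderedCategory (HoCat K) where
  exists_isLUB {A B} a ha := by
    choose f hf using fun i ↦ hoMap_surjective (a i)
    obtain rfl : (fun i ↦ hoMap (f i)) = a := funext hf
    obtain ⟨s, hs⟩ := ZeroInftyCategory.exists_sup f (isOmegaChain_iff.2 ha)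
    exact ⟨hoMap s, isSup_iff.1 hs⟩
  isLUB_comp {A B D a b s t} ha hb hs ht := by
    choose f hf using fun i ↦ hoMap_surjective (a i)
    obtain rfl : (fun i ↦ hoMap (f i)) = a := funext hf
    choose g hg using fun i ↦ hoMap_surjective (b i)
    obtain rfl : (fun i ↦ hoMap (g i)) = b := funext hg
    obtain ⟨s, rfl⟩ := hoMap_surjective s
    obtain ⟨t, rfl⟩ := hoMap_surjective t
    choose h hh using fun i ↦ hoMap_surjective (hoMap (f i) ≫ hoMap (g i))
    obtain ⟨r, hr⟩ := hoMap_surjective (hoMap s ≫ hoMap t)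
    have := isSup_iff.1 (ZeroInftyCategory.comp_continuous f g h s t r (isOmegaChain_iff.2 ha)
      (isOmegaChain_iff.2 hb) (isSup_iff.2 hs) (isSup_iff.2 ht)
      (fun i ↦ isComp_iff.2 (hh i).symm) (isComp_iff.2 hr.symm))
    simpa only [hh, hr] using this

lemma hasSequentialLimits_hoCat (hK : HasOmegaOpLimits K) : HasSequentialLimits (HoCat K) := by
  intro A m
  choose f hf using fun i ↦ hoMap_surjective (m i)
  obtain ⟨c, hc⟩ := hK ⟨fun i ↦ (A i).pt, f⟩
  refine ⟨hoObj c.pt, fun i ↦ hoMap (c.π i), fun i ↦ ?_, fun B ρ hρ ↦ ?_⟩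
  · rw [← hf]
    exact isComp_iff.1 (c.w i)
  · choose r hr using fun i ↦ hoMap_surjective (ρ i)
    obtain ⟨h, hh, huniq⟩ := hc ⟨B.pt, r, fun i ↦ isComp_iff.2 (by
      rw [hr, hr, hf]; exact hρ i)⟩
    refine ⟨hoMap h, fun i ↦ (isComp_iff.1 (hh i)).trans (hr i), fun h' hh' ↦ ?_⟩
    obtain ⟨h', rfl⟩ := hoMap_surjective h'
    exact (homotopic_iff.1 (huniq h' fun i ↦ isComp_iff.2 ((hh' i).trans (hr i).symm))).symm

lemma isHProj_iff {A B : K _⦋0⦌} {p : Edge A B} {m : Edge B A} :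
    IsHProj p m ↔ hoMap p ≫ hoMap m = 𝟙 _ ∧ hoMap m ≫ hoMap p ≤ 𝟙 _ := by
  refine and_congr isComp_iff ⟨?_, fun h ↦ ?_⟩
  · rintro ⟨e, he, hle⟩
    rw [isComp_iff.1 he]
    exact hoMap_le_iff.2 hle
  · obtain ⟨e, he⟩ := hoMap_surjective (hoMap m ≫ hoMap p)
    rw [← he] at h
    exact ⟨e, isComp_iff.2 he.symm, hoMap_le_iff.1 h⟩

end ZeroInfty

/-! ### Edges and colimits of `K^HPrj` as projection pairs -/

section HPrj

lemma pairEdge_id (K : SSet.{u}) (A : K _⦋0⦌) :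
    pairEdge (Edge.id A) (opEdge (Edge.id A)) = Edge.id (X := K ⊗ K.op) (A, opVertex A) :=
  Edge.ext (Prod.ext rfl (op_σ K 0 (opVertex A)).symm)

variable {K : SSet.{u}} [ZeroInftyCategory K]

lemma isHProj_id (A : K _⦋0⦌) : IsHProj (Edge.id A) (Edge.id A) :=
  isHProj_iff.2 ⟨by simp, by simp⟩

lemma isHProjSimplex_id (A : K _⦋0⦌) :
    IsHProjSimplex (Edge.id (X := K ⊗ K.op) (A, opVertex A)).edge :=
  ⟨A, A, Edge.id A, Edge.id A, by rw [pairEdge_id], isHProj_id A⟩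

/-- The vertex of `K^HPrj` given by a vertex of `K`. -/
def hVertex (A : K _⦋0⦌) : (hPrj K : SSet.{u}) _⦋0⦌ :=
  ⟨(A, opVertex A), fun f ↦ by
    obtain rfl : f = (SimplexCategory.σ 0).op := Quiver.Hom.unop_inj (Subsingleton.elim _ _)
    exact isHProjSimplex_id A⟩

lemma hVertex_surjective (x : (hPrj K : SSet.{u}) _⦋0⦌) : ∃ A : K _⦋0⦌, x = hVertex A := by
  obtain ⟨A, B, p, m, h, -⟩ := x.2 (SimplexCategory.σ 0).op
  refine ⟨A, Subtype.ext ?_⟩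
  exact ((K ⊗ K.op).δ_comp_σ_succ_apply (i := 0) x.1).symm.trans
    ((congrArg ((K ⊗ K.op).δ 1) h).trans (pairEdge p (opEdge m)).src_eq)

/-- Membership tests all maps `⦋1⦌ ⟶ ⦋1⦌`. A surjective one is the identity; any other factors
through `⦋0⦌` and gives the identity pair at an endpoint. -/
lemma mem_hPrj_of_isHProjSimplex {s : (K ⊗ K.op) _⦋1⦌} (hs : IsHProjSimplex s) :
    s ∈ (hPrj K).obj (Opposite.op ⦋1⦌) := by
  rintro ⟨f⟩
  change ⦋1⦌ ⟶ ⦋1⦌ at f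
  change IsHProjSimplex ((K ⊗ K.op).map f.op s)
  by_cases hf : Function.Surjective f.toOrderHom
  · have := SimplexCategory.epi_iff_surjective.2 hf
    obtain rfl := SimplexCategory.eq_id_of_epi f
    rwa [op_id, Functor.map_id_apply]
  · obtain ⟨A, B, p, m, rfl, -⟩ := hs
    obtain ⟨i, g, rfl⟩ := SimplexCategory.eq_comp_δ_of_not_surjective f hf
    obtain rfl : g = SimplexCategory.σ 0 := Subsingleton.elim _ _
    rw [op_comp, Functor.map_comp_apply]
    fin_cases i
    · have := (pairEdge p (opEdge m)).tgt_eq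
      exact (congrArg (fun v ↦ IsHProjSimplex ((K ⊗ K.op).σ 0 v)) this).mpr (isHProjSimplex_id B)
    · have := (pairEdge p (opEdge m)).src_eq
      exact (congrArg (fun v ↦ IsHProjSimplex ((K ⊗ K.op).σ 0 v)) this).mpr (isHProjSimplex_id A)

/-- No map `⦋1⦌ ⟶ ⦋2⦌` is surjective, so every edge of `s` lies in a face. -/
lemma mem_hPrj_of_δ_mem {s : (K ⊗ K.op) _⦋2⦌}
    (hs : ∀ i, (K ⊗ K.op).δ i s ∈ (hPrj K).obj (Opposite.op ⦋1⦌)) :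
    s ∈ (hPrj K).obj (Opposite.op ⦋2⦌) := by
  rintro ⟨f⟩
  change ⦋1⦌ ⟶ ⦋2⦌ at f
  have hf : ¬ Function.Surjective f.toOrderHom := fun h ↦ by
    have := Fintype.card_le_of_surjective _ h
    simp at this
  obtain ⟨i, g, rfl⟩ := SimplexCategory.eq_comp_δ_of_not_surjective f hf
  have := hs i g.op
  rwa [SimplicialObject.δ, ← Functor.map_comp_apply] at this

variable {x y z : (hPrj K : SSet.{u}) _⦋0⦌}

lemma snd_eq_opVertex (x : (hPrj K : SSet.{u}) _⦋0⦌) : x.1.2 = opVertex x.1.1 := by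
  obtain ⟨A, rfl⟩ := hVertex_surjective x
  rfl

/-- The embedding part of an edge of `K^HPrj`. -/
def pos (e : Edge x y) : Edge x.1.1 y.1.1 :=
  Edge.mk e.edge.1.1 (congrArg (fun v ↦ v.1.1) e.src_eq) (congrArg (fun v ↦ v.1.1) e.tgt_eq)

/-- The projection part of an edge of `K^HPrj`. -/
def neg (e : Edge x y) : Edge y.1.1 x.1.1 :=
  Edge.mk (opObjEquiv e.edge.1.2)
    ((δ_opObjEquiv K 1 _).trans (congrArg opObjEquiv
      ((congrArg (fun v ↦ v.1.2) e.tgt_eq).trans (snd_eq_opVertex y))))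
    ((δ_opObjEquiv K 0 _).trans (congrArg opObjEquiv
      ((congrArg (fun v ↦ v.1.2) e.src_eq).trans (snd_eq_opVertex x))))

/-- The edge of `K^HPrj` given by an `h`-projection pair. -/
def hEdge (p : Edge x.1.1 y.1.1) (m : Edge y.1.1 x.1.1) (h : IsHProj p m) : Edge x y :=
  Edge.mk ⟨(pairEdge p (opEdge m)).edge, mem_hPrj_of_isHProjSimplex ⟨_, _, p, m, rfl, h⟩⟩
    (Subtype.ext ((pairEdge p (opEdge m)).src_eq.trans (Prod.ext rfl (snd_eq_opVertex x).symm)))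
    (Subtype.ext ((pairEdge p (opEdge m)).tgt_eq.trans (Prod.ext rfl (snd_eq_opVertex y).symm)))

lemma isHProj_of_edge_eq {A B A' B' : K _⦋0⦌} {p : Edge A B} {m : Edge B A} {p' : Edge A' B'}
    {m' : Edge B' A'} (hp : p'.edge = p.edge) (hm : m'.edge = m.edge) (h : IsHProj p m) :
    IsHProj p' m' := by
  obtain rfl : A' = A := by rw [← p.src_eq, ← p'.src_eq, hp]
  obtain rfl : B' = B := by rw [← p.tgt_eq, ← p'.tgt_eq, hp]
  obtain rfl : p' = p := Edge.ext hp
  obtain rfl : m' = m := Edge.ext hm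
  exact h

lemma isHProj_pos_neg (e : Edge x y) : IsHProj (pos e) (neg e) := by
  have h := e.edge.2 (𝟙 _)
  rw [Functor.map_id_apply] at h
  obtain ⟨A, B, p, m, h, hpm⟩ := h
  exact isHProj_of_edge_eq (congrArg Prod.fst h) (congrArg (fun v ↦ opObjEquiv v.2) h) hpm

/-- A `2`-simplex of the product is an independent pair of `2`-simplices, and passing to the
opposite exchanges the faces `0` and `2`. Lying in `hPrj K` costs nothing extra, as it is tested on
the three faces. -/
lemma isComp_hPrj_iff {e : Edge x y} {f : Edge y z} {g : Edge x z} :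
    IsComp e f g ↔ IsComp (pos e) (pos f) (pos g) ∧ IsComp (neg f) (neg e) (neg g) := by
  constructor
  · rintro ⟨s⟩
    exact ⟨⟨CompStruct.mk s.simplex.1.1 (congrArg (fun v ↦ v.1.1) s.d₂)
        (congrArg (fun v ↦ v.1.1) s.d₀) (congrArg (fun v ↦ v.1.1) s.d₁)⟩,
      ⟨CompStruct.mk (opObjEquiv s.simplex.1.2)
        ((δ_opObjEquiv K 2 _).trans (congrArg (fun v ↦ opObjEquiv v.1.2) s.d₀))
        ((δ_opObjEquiv K 0 _).trans (congrArg (fun v ↦ opObjEquiv v.1.2) s.d₂))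
        ((δ_opObjEquiv K 1 _).trans (congrArg (fun v ↦ opObjEquiv v.1.2) s.d₁))⟩⟩
  · rintro ⟨⟨s⟩, ⟨t⟩⟩
    let σ : (K ⊗ K.op) _⦋2⦌ := (s.simplex, opObjEquiv.symm t.simplex)
    have h₂ : (K ⊗ K.op).δ 2 σ = e.edge.1 :=
      Prod.ext s.d₂ ((op_δ K 2 _).trans (congrArg opObjEquiv.symm t.d₀))
    have h₀ : (K ⊗ K.op).δ 0 σ = f.edge.1 :=
      Prod.ext s.d₀ ((op_δ K 0 _).trans (congrArg opObjEquiv.symm t.d₂))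
    have h₁ : (K ⊗ K.op).δ 1 σ = g.edge.1 :=
      Prod.ext s.d₁ ((op_δ K 1 _).trans (congrArg opObjEquiv.symm t.d₁))
    refine ⟨CompStruct.mk ⟨σ, mem_hPrj_of_δ_mem fun i ↦ ?_⟩ (Subtype.ext h₂) (Subtype.ext h₀)
      (Subtype.ext h₁)⟩
    fin_cases i
    · exact h₀ ▸ f.edge.2
    · exact h₁ ▸ g.edge.2
    · exact h₂ ▸ e.edge.2

/-- The projection pair in the homotopy category given by an edge of `K^HPrj`. -/
@[simps]
def toProjPair (e : Edge x y) : ProjPair (hoObj x.1.1) (hoObj y.1.1) where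
  emb := hoMap (pos e)
  proj := hoMap (neg e)
  emb_proj := (isHProj_iff.1 (isHProj_pos_neg e)).1
  proj_emb := (isHProj_iff.1 (isHProj_pos_neg e)).2

lemma toProjPair_surjective :
    Function.Surjective (toProjPair : Edge x y → ProjPair (hoObj x.1.1) (hoObj y.1.1)) := by
  rintro ⟨p, m, h, h'⟩
  obtain ⟨p, rfl⟩ := hoMap_surjective p
  obtain ⟨m, rfl⟩ := hoMap_surjective m
  exact ⟨hEdge p m (isHProj_iff.2 ⟨h, h'⟩), rfl⟩

lemma isComp_iff_toProjPair {e : Edge x y} {f : Edge y z} {g : Edge x z} :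
    IsComp e f g ↔ (toProjPair e).emb ≫ (toProjPair f).emb = (toProjPair g).emb ∧
      (toProjPair f).proj ≫ (toProjPair e).proj = (toProjPair g).proj := by
  rw [isComp_hPrj_iff, isComp_iff, isComp_iff]
  rfl

lemma toProjPair_id (x : (hPrj K : SSet.{u}) _⦋0⦌) :
    toProjPair (Edge.id x) = ProjPair.id (hoObj x.1.1) := by
  obtain ⟨A, rfl⟩ := hVertex_surjective x
  have h : Edge.id (hVertex A) = hEdge (x := hVertex A) (y := hVertex A) (Edge.id A) (Edge.id A)
      (isHProj_id A) := Edge.ext (Subtype.ext (congrArg Edge.edge (pairEdge_id K A)).symm)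
  rw [h]
  rfl

lemma homotopic_iff_toProjPair {e f : Edge x y} :
    Homotopic e f ↔ toProjPair e = toProjPair f := by
  refine isComp_iff_toProjPair.trans ?_
  rw [toProjPair_id, ProjPair.ext_iff, ProjPair.id_emb, ProjPair.id_proj, Category.comp_id,
    Category.id_comp]

/-- The sequence of projection pairs given by an `ω`-diagram in `K^HPrj`. -/
abbrev OmegaDiagram.toProjPair (D : OmegaDiagram (hPrj K : SSet.{u})) (i : ℕ) :
    ProjPair (hoObj (D.obj i).1.1) (hoObj (D.obj (i + 1)).1.1) :=
  HomotopyDomain.toProjPair (D.map i)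

/-- The cocone of projection pairs given by a cocone in `K^HPrj`. -/
def OmegaCocone.toProjCocone {D : OmegaDiagram (hPrj K : SSet.{u})} (c : OmegaCocone D) :
    ProjCocone (A := fun i ↦ hoObj (D.obj i).1.1) D.toProjPair where
  pt := hoObj c.pt.1.1
  ι i := HomotopyDomain.toProjPair (c.ι i)
  w_emb i := (isComp_iff_toProjPair.1 (c.w i)).1
  w_proj i := (isComp_iff_toProjPair.1 (c.w i)).2

variable {D : OmegaDiagram (hPrj K : SSet.{u})}

lemma exists_toProjCocone_eq (C : ProjCocone (A := fun i ↦ hoObj (D.obj i).1.1) D.toProjPair) :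
    ∃ c : OmegaCocone D, c.toProjCocone = C := by
  obtain ⟨⟨A⟩, ι, w₁, w₂⟩ := C
  choose e he using fun i ↦ toProjPair_surjective (x := D.obj i) (y := hVertex (K := K) A) (ι i)
  obtain rfl : (fun i ↦ toProjPair (e i)) = ι := funext he
  exact ⟨⟨hVertex A, e, fun i ↦ isComp_iff_toProjPair.2 ⟨w₁ i, w₂ i⟩⟩, rfl⟩

lemma isMediating_iff {c c' : OmegaCocone D} {h : Edge c.pt c'.pt} :
    c.IsMediating c' h ↔ c.toProjCocone.IsMediating c'.toProjCocone (toProjPair h) :=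
  forall_congr' fun _ ↦ isComp_iff_toProjPair

/-- Cocones and mediating pairs of the homotopy category all lift to `K^HPrj`, and homotopy of edges
there is equality of projection pairs. -/
lemma isColimit_iff {c : OmegaCocone D} : c.IsColimit ↔ c.toProjCocone.IsColimit := by
  constructor
  · intro hc C
    obtain ⟨c', rfl⟩ := exists_toProjCocone_eq C
    obtain ⟨h, hh, huniq⟩ := hc c'
    refine ⟨toProjPair h, isMediating_iff.1 hh, fun k hk ↦ ?_⟩
    obtain ⟨k, rfl⟩ := toProjPair_surjective k
    exact (homotopic_iff_toProjPair.1 (huniq k (isMediating_iff.2 hk))).symm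
  · intro hc c'
    obtain ⟨k, hk, huniq⟩ := hc c'.toProjCocone
    obtain ⟨h, rfl⟩ := toProjPair_surjective k
    exact ⟨h, isMediating_iff.2 hk, fun h' hh' ↦
      homotopic_iff_toProjPair.2 (huniq _ (isMediating_iff.1 hh')).symm⟩

end HPrj

/-! ### Colimits in a product of simplicial sets -/

section Product

variable {X Y : SSet.{u}}

lemma isComp_pairEdge {x x' x'' : X _⦋0⦌} {y y' y'' : Y _⦋0⦌} {e : Edge x x'} {f : Edge x' x''}
    {g : Edge x x''} {e' : Edge y y'} {f' : Edge y' y''} {g' : Edge y y''} (h : IsComp e f g)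
    (h' : IsComp e' f' g') : IsComp (pairEdge e e') (pairEdge f f') (pairEdge g g') := by
  obtain ⟨s⟩ := h
  obtain ⟨s'⟩ := h'
  exact ⟨CompStruct.mk (X := X ⊗ Y) (s.simplex, s'.simplex)
    (Prod.ext s.d₂ s'.d₂) (Prod.ext s.d₀ s'.d₀) (Prod.ext s.d₁ s'.d₁)⟩

lemma IsComp.map {x y z : X _⦋0⦌} {e : Edge x y} {f : Edge y z} {g : Edge x z}
    (h : IsComp e f g) (φ : X ⟶ Y) : IsComp (e.map φ) (f.map φ) (g.map φ) :=
  h.elim fun s ↦ ⟨s.map φ⟩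

open SemiCartesianMonoidalCategory in
-- A competing cocone in `X` is completed to one in the product by the second component of `c`
-- itself. For uniqueness, a rival edge is paired with the second component of the mediating edge
-- already found.
lemma isColimit_mapCocone_fst {D : OmegaDiagram (X ⊗ Y)} {c : OmegaCocone D}
    (hc : c.IsColimit) : (c.mapCocone (fst X Y)).IsColimit := by
  intro c'
  let d : OmegaCocone D :=
    { pt := (c'.pt, ((snd X Y).app _ c.pt))
      ι i := pairEdge (c'.ι i) ((c.ι i).map (snd X Y))
      w i := isComp_pairEdge (c'.w i) ((c.w i).map (snd X Y)) }
  obtain ⟨h, hh, huniq⟩ := hc d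
  refine ⟨h.map (fst X Y), fun i ↦ (hh i).map (fst X Y), fun h' hh' ↦ ?_⟩
  exact (huniq (pairEdge h' (h.map (snd X Y))) fun i ↦
    isComp_pairEdge (hh' i) ((hh i).map (snd X Y))).elim fun s ↦ ⟨s.map (fst X Y)⟩

open SemiCartesianMonoidalCategory in
lemma isColimit_mapCocone_snd {D : OmegaDiagram (X ⊗ Y)} {c : OmegaCocone D}
    (hc : c.IsColimit) : (c.mapCocone (snd X Y)).IsColimit := by
  intro c'
  let d : OmegaCocone D :=
    { pt := (((fst X Y).app _ c.pt), c'.pt)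
      ι i := pairEdge ((c.ι i).map (fst X Y)) (c'.ι i)
      w i := isComp_pairEdge ((c.w i).map (fst X Y)) (c'.w i) }
  obtain ⟨h, hh, huniq⟩ := hc d
  refine ⟨h.map (snd X Y), fun i ↦ (hh i).map (snd X Y), fun h' hh' ↦ ?_⟩
  exact (huniq (pairEdge (h.map (fst X Y)) h') fun i ↦
    isComp_pairEdge ((hh i).map (fst X Y)) (hh' i)).elim fun s ↦ ⟨s.map (snd X Y)⟩

end Product

/-! ### Local continuity preserves exhaustiveness -/

section Functor

variable {K : SSet.{u}} [ZeroInftyCategory K]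

/-- The functor induced by a locally continuous functor preserves the property that the
idempotents of a family of `h`-projection pairs exhaust their common target. -/
lemma isLUB_hPrjFunctor {F : K.op ⊗ K ⟶ K} (hF : IsLocallyContinuous F)
    {x y : ℕ → (hPrj K : SSet.{u}) _⦋0⦌} {x' y' : (hPrj K : SSet.{u}) _⦋0⦌}
    {e : ∀ i, Edge (x i) x'} {f : ∀ i, Edge (y i) y'}
    (me : Monotone fun i ↦ (toProjPair (e i)).proj ≫ (toProjPair (e i)).emb)
    (mf : Monotone fun i ↦ (toProjPair (f i)).proj ≫ (toProjPair (f i)).emb)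
    (he : IsLUB (Set.range fun i ↦ (toProjPair (e i)).proj ≫ (toProjPair (e i)).emb) (𝟙 _))
    (hf : IsLUB (Set.range fun i ↦ (toProjPair (f i)).proj ≫ (toProjPair (f i)).emb) (𝟙 _)) :
    IsLUB (Set.range fun i ↦
      (toProjPair ((pairEdge (e i) (f i)).map (hPrjFunctor F hF))).proj ≫
        (toProjPair ((pairEdge (e i) (f i)).map (hPrjFunctor F hF))).emb) (𝟙 _) := by
  -- With all vertices of the form `hVertex`, their two components match definitionally, so the
  -- edges of the image have the same endpoints as the edges `mapEdge F _ _`.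
  choose A hA using fun i ↦ hVertex_surjective (x i)
  obtain rfl : x = fun i ↦ hVertex (A i) := funext hA
  choose B hB using fun i ↦ hVertex_surjective (y i)
  obtain rfl : y = fun i ↦ hVertex (B i) := funext hB
  obtain ⟨A', rfl⟩ := hVertex_surjective x'
  obtain ⟨B', rfl⟩ := hVertex_surjective y'
  choose a ha using fun i ↦ hoMap_surjective ((toProjPair (e i)).proj ≫ (toProjPair (e i)).emb)
  choose b hb using fun i ↦ hoMap_surjective ((toProjPair (f i)).proj ≫ (toProjPair (f i)).emb)
  simp only [← ha] at me he
  simp only [← hb] at mf hf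
  have key := isSup_iff.1 (hF a b (Edge.id A') (Edge.id B') (isOmegaChain_iff.2 me)
    (isOmegaChain_iff.2 mf) (isSup_iff.2 he) (isSup_iff.2 hf))
  -- The image pair has projection `F(e⁺, f⁻)` and embedding `F(e⁻, f⁺)`. Since `F` is contravariant
  -- in the first variable, their composite is `F` of the two idempotents.
  have comp : ∀ i, (toProjPair ((pairEdge (e i) (f i)).map (hPrjFunctor F hF))).proj ≫
      (toProjPair ((pairEdge (e i) (f i)).map (hPrjFunctor F hF))).emb =
      hoMap (mapEdge F (a i) (b i)) := fun i ↦
    isComp_iff.1 (isComp_mapEdge F (f := pos (e i)) (g := neg (e i)) (f' := neg (f i))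
      (g' := pos (f i)) (isComp_iff.2 (ha i).symm) (isComp_iff.2 (hb i).symm))
  simp only [comp]
  exact (congrArg (IsLUB _) (congrArg hoMap (mapEdge_id F A' B'))).mp key

end Functor

end HomotopyDomain

open HomotopyDomain

theorem theorem2p4 (K : SSet.{u}) [ZeroInftyCategory K] (hK : HasOmegaOpLimits K)
    (F : K.op ⊗ K ⟶ K) (hF : IsLocallyContinuous F) :
    IsOmegaContinuous (hPrjFunctor F hF) := by
  intro D c hc
  have hC := hasSequentialLimits_hoCat hK
  let c₁ := c.mapCocone (SemiCartesianMonoidalCategory.fst _ _)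
  let c₂ := c.mapCocone (SemiCartesianMonoidalCategory.snd _ _)
  have h₁ := (isColimit_iff.1 (isColimit_mapCocone_fst hc)).isExhaustive hC
  have h₂ := (isColimit_iff.1 (isColimit_mapCocone_snd hc)).isExhaustive hC
  have h := isLUB_hPrjFunctor hF (e := c₁.ι) (f := c₂.ι)
    (c₁.toProjCocone.monotone_proj_emb c₁.toProjCocone)
    (c₂.toProjCocone.monotone_proj_emb c₂.toProjCocone) h₁ h₂
  -- `h` is, by unfolding, the exhaustiveness of the image cocone.
  exact isColimit_iff.2 (ProjCocone.IsExhaustive.isColimit h)
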